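/- For $n\ge 1$ let $K_n(z,w)=n\sum_{j=0}^{n-1}\frac{(nz\bar w)^j}{j!}e^{-\frac n2|z|^2-\frac n2|w|^2}$ $(z,w\in\mathbb{C})$ be the kernel of the Ginibre ensemble (external potential $Q(z)=|z|^2$). Let $dA=\frac1\pi\,dx\,dy$ and let $$d\mu_{n,z}(w)=\frac{|K_n(z,w)|^2}{K_n(z,z)}\,dA(w)$$ be the Berezin measure rooted at $z$. Write $k_z(w)=\frac{1}{z-w}$ for the Cauchy kernel and $\mu_{n,z}(k_z)=\int_{\mathbb{C}} k_z\,d\mu_{n,z}$. Theorem 6.4. For every fixed $z\in\mathbb{C}$ with $|z|>1$, the integral $\mu_{n,z}(k_z)$ converges absolutely for all $n\ge1$, and, as $n\to\infty$, $$\mu_{n,z}(k_z)=\frac{\bar z}{|z|^2-1}-\frac1n\,\frac{\bar z\,(|z|^2+1)}{(|z|^2-1)^3}+O(n^{-2}),$$ where the $O$-constant may depend on $z$. -/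

import Mathlib

open Filter Asymptotics MeasureTheory
open scoped ComplexConjugate

namespace Ginibre

/-- The kernel of the Ginibre ensemble with `n` points (the case `Q(z) = |z|²`):
`K_n(z,w) = n ∑_{j<n} (n z w̄)^j / j! · exp (-n|z|²/2 - n|w|²/2)`. -/
noncomputable def kernel (n : ℕ) (z w : ℂ) : ℂ :=
  (n : ℂ) * ∑ j ∈ Finset.range n, ((n : ℂ) * z * conj w) ^ j / (j.factorial : ℂ)
    * (Real.exp (-(1 / 2) * n * ‖z‖ ^ 2 - (1 / 2) * n * ‖w‖ ^ 2) : ℂ)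

/-- The background measure `dA = (1/π) dx dy` on the complex plane. -/
noncomputable def area : Measure ℂ :=
  ENNReal.ofReal (1 / Real.pi) • (volume : Measure ℂ)

/-- The Berezin kernel `B_n(z,w) = |K_n(z,w)|² / K_n(z,z)`. The diagonal value `K_n(z,z)` is a
nonnegative real number, so taking its real part loses nothing. -/
noncomputable def berezinKernel (n : ℕ) (z w : ℂ) : ℝ :=
  ‖kernel n z w‖ ^ 2 / (kernel n z z).re

/-- The Berezin measure rooted at `z`: `dμ_{n,z}(w) = B_n(z,w) dA(w)`. -/
noncomputable def berezinMeasure (n : ℕ) (z : ℂ) : Measure ℂ :=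
  area.withDensity fun w => ENNReal.ofReal (berezinKernel n z w)

/-- The Cauchy kernel `k_z(w) = 1 / (z - w)`. -/
noncomputable def cauchyKernel (z w : ℂ) : ℂ := 1 / (z - w)

end Ginibre

namespace Ginibre

/-! Write `s = |z|²`. Expanding `|K_n|²` reduces the integral to the Cauchy transforms at `z` of
`w̄^j w^k exp (-n|w|²)`. The identity `w / (z - w) = z / (z - w) - 1` moves `k` to the diagonal,
where Newton's theorem evaluates the radial integral; `integral_gaussMonomial_mul_cauchyKernel`
records the result. Up to the mass outside the disc of radius `|z|`, only pairs `k ≤ j < n` survive,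
and counting the `j` turns the sum into `1 / z` times the mean of `n - k` under the Poisson weights
`(ns)^k / k!` truncated to `k < n` (`integral_cauchyKernel_berezinMeasure`).

The exterior mass is at most `n (s exp (1 - s))^n`, exponentially small because `s > 1`
(`tailSum_le`). The mean is expanded by Stein's identity, which links each moment of `n - k` to the
next with a factor `1 / n` (`abs_truncatedMean_sub_le`). -/

/-! ### Gaussian monomials: integrability, moments, orthogonality. -/

/-- The monomial `w̄^j w^k` against the Gaussian weight `exp (-b|w|²)`. -/
noncomputable def gaussMonomial (b : ℝ) (j k : ℕ) (w : ℂ) : ℂ :=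
  conj w ^ j * w ^ k * (Real.exp (-b * ‖w‖ ^ 2) : ℂ)

theorem continuous_gaussMonomial (b : ℝ) (j k : ℕ) : Continuous (gaussMonomial b j k) := by
  unfold gaussMonomial
  fun_prop

theorem norm_gaussMonomial (b : ℝ) (j k : ℕ) (w : ℂ) :
    ‖gaussMonomial b j k w‖ = ‖w‖ ^ (j + k) * Real.exp (-b * ‖w‖ ^ 2) := by
  rw [gaussMonomial, norm_mul, norm_mul, norm_pow, norm_pow, RCLike.norm_conj,
    Complex.norm_real, Real.norm_of_nonneg (Real.exp_pos _).le, pow_add]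

theorem gaussMonomial_self (b : ℝ) (j : ℕ) (w : ℂ) :
    gaussMonomial b j j w = ((‖w‖ ^ (2 * j) * Real.exp (-b * ‖w‖ ^ 2) : ℝ) : ℂ) := by
  rw [gaussMonomial, ← mul_pow, Complex.conj_mul']
  push_cast
  rw [← pow_mul]

theorem gaussMonomial_succ_right (b : ℝ) (j k : ℕ) (w : ℂ) :
    gaussMonomial b j (k + 1) w = w * gaussMonomial b j k w := by
  simp only [gaussMonomial]
  ring

theorem conj_gaussMonomial (b : ℝ) (j k : ℕ) (w : ℂ) :
    conj (gaussMonomial b j k w) = gaussMonomial b k j w := by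
  simp only [gaussMonomial, map_mul, map_pow, Complex.conj_conj, Complex.conj_ofReal]
  ring

theorem gaussMonomial_circle_mul (b : ℝ) (j k : ℕ) (u : Circle) (w : ℂ) :
    gaussMonomial b j k (u * w) = conj (u : ℂ) ^ j * (u : ℂ) ^ k * gaussMonomial b j k w := by
  simp only [gaussMonomial, map_mul, norm_mul, Circle.norm_coe, one_mul]
  ring

theorem integrable_pow_norm_mul_gaussian {b : ℝ} (hb : 0 < b) (m : ℕ) :
    Integrable fun w : ℂ => ‖w‖ ^ m * Real.exp (-b * ‖w‖ ^ 2) := by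
  have h := (integrable_fun_norm_addHaar (volume : Measure ℂ)
    (f := fun r : ℝ => r ^ m * Real.exp (-b * r ^ 2))).2
  refine h ?_
  have h2 := integrableOn_rpow_mul_exp_neg_mul_sq hb (s := (m + 1 : ℕ))
    (by have : (0 : ℝ) ≤ ((m + 1 : ℕ) : ℝ) := Nat.cast_nonneg _
        linarith)
  refine h2.congr_fun (fun r _ => ?_) measurableSet_Ioi
  simp only [Complex.finrank_real_complex, Real.rpow_natCast, smul_eq_mul]
  ring

theorem integrable_gaussMonomial {b : ℝ} (hb : 0 < b) (j k : ℕ) :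
    Integrable (gaussMonomial b j k) := by
  refine (integrable_pow_norm_mul_gaussian hb (j + k)).mono'
    (continuous_gaussMonomial b j k).aestronglyMeasurable (ae_of_all _ fun w => ?_)
  rw [norm_gaussMonomial]

theorem integral_pow_norm_mul_gaussian {b : ℝ} (hb : 0 < b) (j : ℕ) :
    ∫ w : ℂ, ‖w‖ ^ (2 * j) * Real.exp (-b * ‖w‖ ^ 2)
      = Real.pi * j.factorial / b ^ (j + 1) := by
  have h := Complex.integral_rpow_mul_exp_neg_mul_rpow (p := 2) (q := (2 * j : ℕ)) one_le_two
    (by have : (0 : ℝ) ≤ ((2 * j : ℕ) : ℝ) := Nat.cast_nonneg _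
        linarith) hb
  simp only [Real.rpow_natCast, Real.rpow_two] at h
  rw [h]
  have e : (((2 * j : ℕ) : ℝ) + 2) / 2 = (j : ℝ) + 1 := by push_cast; ring
  rw [neg_div, e, Real.Gamma_nat_eq_factorial, Real.rpow_neg hb.le,
    show (j : ℝ) + 1 = ((j + 1 : ℕ) : ℝ) by push_cast; ring, Real.rpow_natCast]
  ring

theorem integral_comp_circle_mul (u : Circle) (F : ℂ → ℂ) :
    ∫ w, F (u * w) = ∫ w, F w := by
  have h := (rotation u).measurePreserving.integral_comp
    (rotation u).toHomeomorph.measurableEmbedding F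
  simpa [rotation_apply] using h

theorem integral_gaussMonomial_of_lt (b : ℝ) {j k : ℕ} (hjk : j < k) :
    ∫ w, gaussMonomial b j k w = 0 := by
  have hm : ((k - j : ℕ) : ℝ) ≠ 0 := by
    have : k - j ≠ 0 := by omega
    exact_mod_cast this
  -- This rotation multiplies the monomial by `u ^ (k - j) = -1`, so the integral equals its own
  -- negative.
  set u : Circle := Circle.exp (Real.pi / (k - j : ℕ)) with hu
  have hpow : (u : ℂ) ^ (k - j) = -1 := by
    rw [hu, Circle.coe_exp, ← Complex.exp_nat_mul]
    have : ((k - j : ℕ) : ℂ) * (((Real.pi / (k - j : ℕ) : ℝ) : ℂ) * Complex.I)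
        = Real.pi * Complex.I := by
      have hm' : ((k - j : ℕ) : ℂ) ≠ 0 := by exact_mod_cast hm
      push_cast
      field_simp
    rw [this, Complex.exp_pi_mul_I]
  have hc : conj (u : ℂ) ^ j * (u : ℂ) ^ k = -1 := by
    rw [← hpow, ← Nat.add_sub_cancel' hjk.le, pow_add, ← mul_assoc, ← mul_pow, Complex.conj_mul',
      Circle.norm_coe]
    simp
  have h := integral_comp_circle_mul u (gaussMonomial b j k)
  simp only [gaussMonomial_circle_mul, hc] at h
  rw [integral_const_mul] at h
  linear_combination (-1 / 2 : ℂ) * h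

theorem integral_gaussMonomial_of_ne (b : ℝ) {j k : ℕ} (hjk : j ≠ k) :
    ∫ w, gaussMonomial b j k w = 0 := by
  rcases lt_or_gt_of_ne hjk with h | h
  · exact integral_gaussMonomial_of_lt b h
  · have h2 := integral_gaussMonomial_of_lt b h
    have h3 := integral_conj (μ := (volume : Measure ℂ)) (f := gaussMonomial b k j)
    simp only [conj_gaussMonomial] at h3
    rw [h3, h2, map_zero]

theorem integral_gaussMonomial_self {b : ℝ} (hb : 0 < b) (j : ℕ) :
    ∫ w, gaussMonomial b j j w = ((Real.pi * j.factorial / b ^ (j + 1) : ℝ) : ℂ) := by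
  rw [← integral_pow_norm_mul_gaussian hb, ← integral_complex_ofReal]
  exact integral_congr_ae (ae_of_all _ fun w => gaussMonomial_self b j w)

/-! ### Integrability against the Cauchy kernel. -/

theorem locallyIntegrable_cauchyKernel (z : ℂ) : LocallyIntegrable (cauchyKernel z) := by
  have h : LocallyIntegrable (fun w : ℂ => w⁻¹) := by
    refine locallyIntegrable_of_norm_le_rpow (C := 1) (α := 1) (by simp) (by simp)
      (ae_of_all _ fun w => ?_) (measurable_inv.aestronglyMeasurable)
    rw [norm_inv, Real.rpow_neg_one, one_mul]
  rw [locallyIntegrable_iff] at h ⊢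
  intro K hK
  have hK' : IsCompact ((fun w => z - w) ⁻¹' K) := by
    have := (Homeomorph.subLeft z).isCompact_preimage.2 hK
    exact this
  have h2 := (Measure.measurePreserving_sub_left (volume : Measure ℂ) z).integrableOn_comp_preimage
    (MeasurableEquiv.subLeft z).measurableEmbedding (f := fun w : ℂ => w⁻¹)
    (s := (fun w => z - w) ⁻¹' K)
  have h3 := h2.2 (h _ hK')
  refine (h3.congr_fun (fun w _ => ?_) ?_).mono_set (fun w hw => ?_)
  · simp [cauchyKernel]
  · exact (measurable_const.sub measurable_id) ((measurable_const.sub measurable_id) hK.measurableSet)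
  · simpa using hw

theorem measurable_cauchyKernel (z : ℂ) : Measurable (cauchyKernel z) := by
  unfold cauchyKernel
  fun_prop

/-- Near `z` the singularity is locally integrable and `h` is bounded; at distance more than 1 the
kernel is bounded by 1. -/
theorem integrable_mul_cauchyKernel {h : ℂ → ℂ} (hc : Continuous h) (hi : Integrable h) (z : ℂ) :
    Integrable fun w => h w * cauchyKernel z w := by
  have h1 : IntegrableOn (fun w => h w * cauchyKernel z w) (Metric.closedBall z 1) :=
    IntegrableOn.continuousOn_mul hc.continuousOn
      ((locallyIntegrable_cauchyKernel z).integrableOn_isCompact (isCompact_closedBall z 1))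
      (isCompact_closedBall z 1)
  have h2 : IntegrableOn (fun w => h w * cauchyKernel z w) (Metric.closedBall z 1)ᶜ := by
    refine Integrable.mono' hi.norm.integrableOn
      (hc.measurable.mul (measurable_cauchyKernel z)).aestronglyMeasurable ?_
    filter_upwards [ae_restrict_mem Metric.isClosed_closedBall.measurableSet.compl] with w hw
    rw [norm_mul, cauchyKernel, norm_div, norm_one]
    have : 1 < ‖z - w‖ := by
      simpa [dist_eq_norm, norm_sub_rev] using hw
    exact mul_le_of_le_one_right (norm_nonneg _) ((div_le_one (by linarith)).2 this.le)
  simpa using h1.union h2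

/-- Integrates `w / (z - w) = z / (z - w) - 1`, valid off the null set `{z}`. -/
theorem integral_gaussMonomial_succ_mul_cauchyKernel {b : ℝ} (hb : 0 < b) (j k : ℕ) (z : ℂ) :
    ∫ w, gaussMonomial b j (k + 1) w * cauchyKernel z w
      = z * (∫ w, gaussMonomial b j k w * cauchyKernel z w) - ∫ w, gaussMonomial b j k w := by
  have hi := integrable_mul_cauchyKernel (continuous_gaussMonomial b j k)
    (integrable_gaussMonomial hb j k) z
  rw [← integral_const_mul, ← integral_sub (hi.const_mul z) (integrable_gaussMonomial hb j k)]
  refine integral_congr_ae ?_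
  have hz : ∀ᵐ w : ℂ, w ≠ z := by
    simp [ae_iff]
  filter_upwards [hz] with w hw
  have : z - w ≠ 0 := sub_ne_zero.2 hw.symm
  rw [gaussMonomial_succ_right, cauchyKernel]
  field_simp
  ring

/-! ### Circle averages of the Cauchy kernel and Newton's theorem. -/

-- Mean value property: the pole `u = z / w` lies outside the closed unit disc, so the average is
-- the value at `u = 0`.
open Real in
theorem circleAverage_cauchyKernel_of_lt {z w : ℂ} (h : ‖w‖ < ‖z‖) :
    circleAverage (fun u => cauchyKernel z (u * w)) 0 1 = 1 / z := by
  have hne : ∀ u ∈ Metric.closedBall (0 : ℂ) 1, z - u * w ≠ 0 := by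
    intro u hu h0
    have hu' : ‖u‖ ≤ 1 := by simpa using hu
    have : ‖z‖ = ‖u‖ * ‖w‖ := by rw [← norm_mul, sub_eq_zero.1 h0]
    nlinarith [norm_nonneg w, norm_nonneg u]
  have hd : DifferentiableOn ℂ (fun u => cauchyKernel z (u * w)) (Metric.closedBall (0 : ℂ) 1) := by
    unfold cauchyKernel
    exact DifferentiableOn.div (by fun_prop) (by fun_prop) hne
  have h2 : DiffContOnCl ℂ (fun u => cauchyKernel z (u * w)) (Metric.ball (0 : ℂ) |1|) := by
    refine DifferentiableOn.diffContOnCl ?_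
    rw [closure_ball _ (by simp), abs_one]
    exact hd
  rw [h2.circleAverage]
  simp [cauchyKernel]

-- With the pole `a = z / w` inside the disc, the kernel is `(1 / z) (1 - u / (u - a))`, and
-- Cauchy's formula gives `u / (u - a)` average 1.
open Real in
theorem circleAverage_cauchyKernel_of_gt {z w : ℂ} (hz : z ≠ 0) (h : ‖z‖ < ‖w‖) :
    circleAverage (fun u => cauchyKernel z (u * w)) 0 1 = 0 := by
  have hw : w ≠ 0 := norm_pos_iff.1 (lt_of_le_of_lt (norm_nonneg z) h)
  have hzw : z / w ∈ Metric.ball (0 : ℂ) |1| := by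
    rw [mem_ball_zero_iff, norm_div, abs_one]
    exact (div_lt_one (norm_pos_iff.2 hw)).2 h
  have h1 : circleAverage (fun u => ((u - 0) / (u - z / w)) • (1 : ℂ)) 0 1 = 1 :=
    (diffContOnCl_const (c := (1 : ℂ))).circleAverage_smul_div hzw
  have hne : ∀ u ∈ Metric.sphere (0 : ℂ) |1|, u - z / w ≠ 0 := by
    intro u hu h0
    rw [sub_eq_zero.1 h0] at hu
    simp only [abs_one, mem_sphere_zero_iff_norm] at hu
    simp only [abs_one, mem_ball_zero_iff] at hzw
    linarith
  have hci : CircleIntegrable (fun u => ((u - 0) / (u - z / w)) • (1 : ℂ)) 0 1 := by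
    refine ContinuousOn.circleIntegrable' ?_
    exact ContinuousOn.smul (ContinuousOn.div (by fun_prop) (by fun_prop) hne) continuousOn_const
  have h2 : circleAverage (fun u => cauchyKernel z (u * w)) 0 1
      = circleAverage (fun u => (1 / z) • ((fun _ => (1 : ℂ)) u
          - (fun u => ((u - 0) / (u - z / w)) • (1 : ℂ)) u)) 0 1 := by
    refine circleAverage_congr_sphere fun u hu => ?_
    have h3 := hne u hu
    have h4 : z - u * w ≠ 0 := by
      intro h0
      apply h3
      rw [sub_eq_zero.1 h0]
      field_simp
      simp
    have h5 : u * w - z ≠ 0 := by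
      intro h0
      apply h4
      linear_combination -h0
    have h6 : u - z / w = (u * w - z) / w := by field_simp
    simp only [cauchyKernel, smul_eq_mul, sub_zero, mul_one, h6]
    field_simp
    ring
  rw [h2, circleAverage_fun_smul, circleAverage_fun_sub (circleIntegrable_const _ _ _) hci, h1,
    circleAverage_const]
  simp

-- Every rotation of the kernel has the same integral against a radial `h`; average over the angle
-- and apply Fubini.
open Real in
theorem integral_radial_mul_cauchyKernel_eq_circleAverage {h : ℂ → ℂ} (hc : Continuous h)
    (hi : Integrable h) (hr : ∀ (u : Circle) (w : ℂ), h (u * w) = h w) (z : ℂ) :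
    ∫ w, h w * cauchyKernel z w
      = ∫ w, h w * circleAverage (fun u => cauchyKernel z (u * w)) 0 1 := by
  have hrot : ∀ θ : ℝ, ∀ w : ℂ, h w * cauchyKernel z (circleMap 0 1 θ * w)
      = (fun w => h w * cauchyKernel z w) (Circle.exp θ * w) := by
    intro θ w
    simp only [hr]
    simp [circleMap]
  have hint := integrable_mul_cauchyKernel hc hi z
  have hrotint : ∀ θ : ℝ, Integrable fun w => h w * cauchyKernel z (circleMap 0 1 θ * w) := by
    intro θ
    simp only [hrot]
    exact ((rotation (Circle.exp θ)).measurePreserving.integrable_comp_emb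
      (rotation (Circle.exp θ)).toHomeomorph.measurableEmbedding
      (g := fun w => h w * cauchyKernel z w)).2 hint
  have hnorm : ∀ θ : ℝ, ∫ w, ‖h w * cauchyKernel z (circleMap 0 1 θ * w)‖
      = ∫ w, ‖h w * cauchyKernel z w‖ := by
    intro θ
    simp only [hrot]
    exact (rotation (Circle.exp θ)).measurePreserving.integral_comp
      (rotation (Circle.exp θ)).toHomeomorph.measurableEmbedding
      (fun w => ‖h w * cauchyKernel z w‖)
  have hval : ∀ θ : ℝ, ∫ w, h w * cauchyKernel z (circleMap 0 1 θ * w)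
      = ∫ w, h w * cauchyKernel z w := by
    intro θ
    simp only [hrot]
    exact integral_comp_circle_mul (Circle.exp θ) (fun w => h w * cauchyKernel z w)
  -- The `L¹` norm in `w` does not depend on `θ`, so it is integrable over the bounded range of
  -- angles.
  have hprod : Integrable
      (Function.uncurry fun (θ : ℝ) (w : ℂ) => h w * cauchyKernel z (circleMap 0 1 θ * w))
      ((volume.restrict (Set.Ioc 0 (2 * π))).prod volume) := by
    refine (integrable_prod_iff ?_).2 ⟨ae_of_all _ hrotint, ?_⟩
    · refine Measurable.aestronglyMeasurable ?_
      refine (hc.measurable.comp measurable_snd).mul ((measurable_cauchyKernel z).comp ?_)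
      exact (((continuous_circleMap 0 1).measurable).comp measurable_fst).mul measurable_snd
    · simp only [Function.uncurry, hnorm]
      exact integrable_const _
  have hswap := integral_integral_swap hprod
  simp only [hval] at hswap
  simp only [circleAverage_def, intervalIntegral.integral_of_le two_pi_pos.le]
  have h2 : ∀ w, h w * ((2 * π)⁻¹ • ∫ θ in Set.Ioc 0 (2 * π), cauchyKernel z (circleMap 0 1 θ * w))
      = ((2 * π)⁻¹ : ℝ) • ∫ θ in Set.Ioc 0 (2 * π), h w * cauchyKernel z (circleMap 0 1 θ * w) := by
    intro w
    rw [integral_const_mul, mul_smul_comm]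
  simp only [h2]
  rw [integral_smul, ← hswap, setIntegral_const, smul_smul]
  have hpi : (π : ℂ) ≠ 0 := by exact_mod_cast pi_ne_zero
  simp [pi_pos.le]
  field_simp

/-- **Newton's theorem** in the plane: a rotation invariant charge acts on `z` as if the part of it
closer to the origin than `z` were concentrated at the origin. -/
theorem integral_radial_mul_cauchyKernel {h : ℂ → ℂ} (hc : Continuous h)
    (hi : Integrable h) (hr : ∀ (u : Circle) (w : ℂ), h (u * w) = h w) {z : ℂ} (hz : z ≠ 0) :
    ∫ w, h w * cauchyKernel z w
      = 1 / z * ((∫ w, h w) - ∫ w in (Metric.ball (0 : ℂ) ‖z‖)ᶜ, h w) := by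
  rw [integral_radial_mul_cauchyKernel_eq_circleAverage hc hi hr]
  have h1 : (∫ w, h w) - ∫ w in (Metric.ball (0 : ℂ) ‖z‖)ᶜ, h w
      = ∫ w in Metric.ball (0 : ℂ) ‖z‖, h w := by
    rw [← integral_add_compl Metric.isOpen_ball.measurableSet hi]
    ring
  rw [h1, ← integral_indicator Metric.isOpen_ball.measurableSet, ← integral_const_mul]
  refine integral_congr_ae ?_
  have hs : ∀ᵐ w : ℂ, w ∉ Metric.sphere (0 : ℂ) ‖z‖ := by
    exact measure_eq_zero_iff_ae_notMem.1 (Measure.addHaar_sphere _ _ _)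
  filter_upwards [hs] with w hw
  rw [mem_sphere_zero_iff_norm] at hw
  rcases lt_or_gt_of_ne hw with hlt | hgt
  · rw [circleAverage_cauchyKernel_of_lt hlt, Set.indicator_of_mem (by simpa using hlt), mul_comm]
  · rw [circleAverage_cauchyKernel_of_gt hz hgt, Set.indicator_of_notMem (by simpa using hgt.le)]
    simp

/-! ### Gaussian tails and Cauchy transforms of the monomials. -/

/-- The mass of `|w|^(2j) exp (-b|w|²)` outside the disc of radius `R`. -/
noncomputable def gaussTail (b R : ℝ) (j : ℕ) : ℝ :=
  ∫ w in (Metric.ball (0 : ℂ) R)ᶜ, ‖w‖ ^ (2 * j) * Real.exp (-b * ‖w‖ ^ 2)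

theorem gaussTail_nonneg (b R : ℝ) (j : ℕ) : 0 ≤ gaussTail b R j :=
  integral_nonneg fun w => by positivity

/-- A Chernoff bound: slow the decay rate from `b` to `b / R²`, at the price of a constant making
the two weights agree on `|w| = R`, then integrate over the whole plane. -/
theorem gaussTail_le {b R : ℝ} (hb : 0 < b) (hR : 1 < R) (j : ℕ) :
    gaussTail b R j ≤ Real.exp (-b * (R ^ 2 - 1))
      * (Real.pi * j.factorial / (b / R ^ 2) ^ (j + 1)) := by
  have hR0 : 0 < R := by linarith
  have hb' : 0 < b / R ^ 2 := by positivity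
  rw [← integral_pow_norm_mul_gaussian hb', ← integral_const_mul]
  have hint := (integrable_pow_norm_mul_gaussian hb' (2 * j)).const_mul
    (Real.exp (-b * (R ^ 2 - 1)))
  refine le_trans (setIntegral_mono_on
    (integrable_pow_norm_mul_gaussian hb (2 * j)).integrableOn hint.integrableOn
    Metric.isOpen_ball.measurableSet.compl fun w hw => ?_)
    (setIntegral_le_integral hint (ae_of_all _ fun w => by positivity))
  have hw' : R ≤ ‖w‖ := by simpa using hw
  rw [mul_left_comm, ← Real.exp_add]
  refine mul_le_mul_of_nonneg_left (Real.exp_le_exp.2 ?_) (by positivity)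
  have h1 : R ^ 2 ≤ ‖w‖ ^ 2 := by gcongr
  have h2 : 0 ≤ b * (R ^ 2 - 1) / R ^ 2 * (‖w‖ ^ 2 - R ^ 2) :=
    mul_nonneg (div_nonneg (mul_nonneg hb.le (by nlinarith)) (by positivity)) (by linarith)
  have h3 : b * (R ^ 2 - 1) / R ^ 2 * (‖w‖ ^ 2 - R ^ 2)
      = -b * (R ^ 2 - 1) + -(b / R ^ 2) * ‖w‖ ^ 2 - -b * ‖w‖ ^ 2 := by
    field_simp
    ring
  linarith

theorem integral_gaussMonomial_mul_cauchyKernel_of_le {b : ℝ} (hb : 0 < b) (z : ℂ)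
    {j k : ℕ} (hjk : k ≤ j) :
    ∫ w, gaussMonomial b j k w * cauchyKernel z w
      = z ^ k * ∫ w, gaussMonomial b j 0 w * cauchyKernel z w := by
  induction k with
  | zero => simp
  | succ k ih =>
    rw [integral_gaussMonomial_succ_mul_cauchyKernel hb, ih (by omega),
      integral_gaussMonomial_of_ne b (by omega)]
    ring

/-- By orthogonality the recursion in `k` picks up a correction only on passing from `j` to `j + 1`;
each later step multiplies it by `z`. -/
theorem integral_gaussMonomial_mul_cauchyKernel_of_lt {b : ℝ} (hb : 0 < b) {z : ℂ} (hz : z ≠ 0)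
    {j k : ℕ} (hjk : j < k) :
    ∫ w, gaussMonomial b j k w * cauchyKernel z w
      = z ^ k * (∫ w, gaussMonomial b j 0 w * cauchyKernel z w)
        - z ^ k / z ^ (j + 1) * ∫ w, gaussMonomial b j j w := by
  induction k, hjk using Nat.le_induction with
  | base =>
    rw [integral_gaussMonomial_succ_mul_cauchyKernel hb,
      integral_gaussMonomial_mul_cauchyKernel_of_le hb z le_rfl, Nat.succ_eq_add_one,
      div_self (pow_ne_zero _ hz)]
    ring
  | succ k hk ih =>
    rw [integral_gaussMonomial_succ_mul_cauchyKernel hb, ih,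
      integral_gaussMonomial_of_ne b (Nat.lt_of_succ_le hk).ne]
    ring

theorem integral_gaussMonomial_mul_cauchyKernel {b : ℝ} (hb : 0 < b) {z : ℂ} (hz : z ≠ 0)
    (j k : ℕ) :
    ∫ w, gaussMonomial b j k w * cauchyKernel z w
      = z ^ k / z ^ (j + 1) * (((Real.pi * j.factorial / b ^ (j + 1)
          * (if j < k then 0 else 1) - gaussTail b ‖z‖ j : ℝ)) : ℂ) := by
  have hdiag : ∫ w, gaussMonomial b j j w * cauchyKernel z w
      = 1 / z * (((Real.pi * j.factorial / b ^ (j + 1) - gaussTail b ‖z‖ j : ℝ)) : ℂ) := by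
    rw [integral_radial_mul_cauchyKernel (continuous_gaussMonomial b j j)
      (integrable_gaussMonomial hb j j) (fun u w => ?_) hz, integral_gaussMonomial_self hb,
      gaussTail, Complex.ofReal_sub, ← integral_complex_ofReal]
    · simp only [gaussMonomial_self]
    · rw [gaussMonomial_circle_mul, ← mul_pow, Complex.conj_mul', Circle.norm_coe]
      simp
  -- The recursion leaves the value at `k = 0` unknown; the radial case `k = j` determines it.
  have hzero := integral_gaussMonomial_mul_cauchyKernel_of_le hb z (le_refl j)
  rw [hdiag] at hzero
  have hzero' : ∫ w, gaussMonomial b j 0 w * cauchyKernel z w = 1 / z ^ (j + 1)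
      * (((Real.pi * j.factorial / b ^ (j + 1) - gaussTail b ‖z‖ j : ℝ)) : ℂ) := by
    have : z ^ j ≠ 0 := pow_ne_zero _ hz
    rw [pow_succ]
    field_simp
    field_simp at hzero
    rw [hzero]
    ring
  by_cases hjk : j < k
  · rw [integral_gaussMonomial_mul_cauchyKernel_of_lt hb hz hjk, hzero',
      integral_gaussMonomial_self hb, if_pos hjk]
    push_cast
    ring
  · rw [integral_gaussMonomial_mul_cauchyKernel_of_le hb z (not_lt.1 hjk), hzero', if_neg hjk]
    push_cast
    ring

/-! ### Moments of the truncated Poisson weights. -/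

/-- The truncated exponential sum `∑_{k<n} x^k / k!` with the weights `g (n - k)`. -/
noncomputable def weightedExpSum (n : ℕ) (x : ℝ) (g : ℝ → ℝ) : ℝ :=
  ∑ k ∈ Finset.range n, x ^ k / k.factorial * g (n - k)

/-- Stein's identity for the truncated Poisson weights. -/
theorem weightedExpSum_stein (n : ℕ) (x : ℝ) (g : ℝ → ℝ) (hg : g 0 = 0) :
    weightedExpSum n x (fun d => (n - d) * g d) = x * weightedExpSum n x (fun d => g (d - 1)) := by
  cases n with
  | zero => simp [weightedExpSum]
  | succ m =>
    simp only [weightedExpSum]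
    -- On the left the factor `n - d = k` kills `k = 0`; on the right the last index carries `g 0 =
    -- 0`. The remaining terms match after shifting `k`.
    rw [Finset.sum_range_succ', Finset.sum_range_succ, mul_add, Finset.mul_sum]
    congr 1
    · refine Finset.sum_congr rfl fun k _ => ?_
      rw [show ((m + 1 : ℕ) : ℝ) - ((k + 1 : ℕ) : ℝ) = ((m + 1 : ℕ) : ℝ) - (k : ℝ) - 1 by
        push_cast; ring, pow_succ, Nat.factorial_succ]
      have h1 : (k.factorial : ℝ) ≠ 0 := by exact_mod_cast k.factorial_ne_zero
      have h2 : (k : ℝ) + 1 ≠ 0 := by positivity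
      push_cast
      field_simp
      ring
    · rw [show ((m + 1 : ℕ) : ℝ) - (m : ℝ) - 1 = 0 by push_cast; ring, hg]
      simp

theorem weightedExpSum_congr {n : ℕ} {x : ℝ} {g h : ℝ → ℝ} (hgh : ∀ d, g d = h d) :
    weightedExpSum n x g = weightedExpSum n x h := by
  rw [funext hgh]

theorem weightedExpSum_add (n : ℕ) (x : ℝ) (g h : ℝ → ℝ) :
    weightedExpSum n x (fun d => g d + h d) = weightedExpSum n x g + weightedExpSum n x h := by
  simp only [weightedExpSum, mul_add, Finset.sum_add_distrib]

theorem weightedExpSum_const_mul (n : ℕ) (x c : ℝ) (g : ℝ → ℝ) :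
    weightedExpSum n x (fun d => c * g d) = c * weightedExpSum n x g := by
  simp only [weightedExpSum, Finset.mul_sum]
  exact Finset.sum_congr rfl fun k _ => by ring

theorem weightedExpSum_nonneg {n : ℕ} {x : ℝ} (hx : 0 ≤ x) (m : ℕ) :
    0 ≤ weightedExpSum n x (fun d => d ^ m) := by
  refine Finset.sum_nonneg fun k hk => ?_
  have : (k : ℝ) ≤ n := by exact_mod_cast (Finset.mem_range.1 hk).le
  exact mul_nonneg (by positivity) (pow_nonneg (by linarith) _)

theorem weightedExpSum_one_pos {n : ℕ} (hn : 1 ≤ n) {x : ℝ} (hx : 0 < x) :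
    0 < weightedExpSum n x (fun _ => 1) := by
  refine Finset.sum_pos (fun k _ => by positivity) ⟨0, Finset.mem_range.2 hn⟩

/-- The constant in the second order expansion of `truncatedMean`. -/
noncomputable def expansionBound (s : ℝ) : ℝ :=
  2 * s / (s - 1) ^ 3 * (2 * s * (s / (s - 1)) / (s - 1))
    + (3 * s * (2 * s * (s / (s - 1)) / (s - 1)) + s) / (s - 1) / (s - 1) ^ 2

/-- The mean of `n - k` with respect to the weights `(ns)^k / k!`, `k < n`. -/
noncomputable def truncatedMean (n : ℕ) (s : ℝ) : ℝ :=
  weightedExpSum n (n * s) (fun d => d) / weightedExpSum n (n * s) (fun _ => 1)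

/-- Stein's identity for `d`, `d²`, `d³` gives three relations between the normalized moments `e m`.
The first two yield the expansion with an exact remainder in `e 2` and `e 3`; the third serves only
to bound `e 3`. -/
theorem abs_truncatedMean_sub_le {n : ℕ} (hn : 1 ≤ n) {s : ℝ} (hs : 1 < s) :
    |truncatedMean n s - (s / (s - 1) - 1 / n * (s * (s + 1) / (s - 1) ^ 3))|
      ≤ expansionBound s / (n : ℝ) ^ 2 := by
  have hn0 : (0 : ℝ) < n := by exact_mod_cast hn
  have hs1 : 0 < s - 1 := by linarith
  have hx : (0 : ℝ) < n * s := by positivity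
  set x : ℝ := n * s with hxdef
  have hp := weightedExpSum_one_pos hn hx
  set p := weightedExpSum n x (fun _ => 1) with hpdef
  set T : ℕ → ℝ := fun m => weightedExpSum n x (fun d => d ^ m) with hT
  have hT1 : weightedExpSum n x (fun d => d) = T 1 := weightedExpSum_congr fun d => by simp
  have hlin : ∀ c₀ c₁ c₂ c₃ c₄ : ℝ, weightedExpSum n x
      (fun d => c₀ * 1 + (c₁ * d ^ 1 + (c₂ * d ^ 2 + (c₃ * d ^ 3 + c₄ * d ^ 4))))
      = c₀ * p + (c₁ * T 1 + (c₂ * T 2 + (c₃ * T 3 + c₄ * T 4))) := by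
    intro c₀ c₁ c₂ c₃ c₄
    simp only [weightedExpSum_add, weightedExpSum_const_mul, hT, hpdef]
  have i1 : (n : ℝ) * T 1 - T 2 = x * (T 1 - p) := by
    have h := weightedExpSum_stein n x (fun d => d) rfl
    rw [weightedExpSum_congr (h := fun d => 0 * 1 + ((n : ℝ) * d ^ 1 + ((-1) * d ^ 2
        + (0 * d ^ 3 + 0 * d ^ 4)))) (fun d => by ring),
      weightedExpSum_congr (g := fun d => d - 1) (h := fun d => (-1) * 1 + (1 * d ^ 1
        + (0 * d ^ 2 + (0 * d ^ 3 + 0 * d ^ 4)))) (fun d => by ring), hlin, hlin] at h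
    linarith
  have i2 : (n : ℝ) * T 2 - T 3 = x * (T 2 - 2 * T 1 + p) := by
    have h := weightedExpSum_stein n x (fun d => d ^ 2) (by norm_num)
    rw [weightedExpSum_congr (h := fun d => 0 * 1 + (0 * d ^ 1 + ((n : ℝ) * d ^ 2
        + ((-1) * d ^ 3 + 0 * d ^ 4)))) (fun d => by ring),
      weightedExpSum_congr (g := fun d => (d - 1) ^ 2) (h := fun d => 1 * 1 + ((-2) * d ^ 1
        + (1 * d ^ 2 + (0 * d ^ 3 + 0 * d ^ 4)))) (fun d => by ring), hlin, hlin] at h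
    linarith
  have i3 : (n : ℝ) * T 3 - T 4 = x * (T 3 - 3 * T 2 + 3 * T 1 - p) := by
    have h := weightedExpSum_stein n x (fun d => d ^ 3) (by norm_num)
    rw [weightedExpSum_congr (h := fun d => 0 * 1 + (0 * d ^ 1 + (0 * d ^ 2
        + ((n : ℝ) * d ^ 3 + (-1) * d ^ 4)))) (fun d => by ring),
      weightedExpSum_congr (g := fun d => (d - 1) ^ 3) (h := fun d => (-1) * 1 + (3 * d ^ 1
        + ((-3) * d ^ 2 + (1 * d ^ 3 + 0 * d ^ 4)))) (fun d => by ring), hlin, hlin] at h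
    linarith
  have hTn : ∀ m, 0 ≤ T m := fun m => weightedExpSum_nonneg hx.le m
  have hmean : truncatedMean n s = T 1 / p := by rw [truncatedMean, ← hxdef, hT1]
  set e : ℕ → ℝ := fun m => T m / p with he
  have hen : ∀ m, 0 ≤ e m := fun m => div_nonneg (hTn m) hp.le
  have hTe : ∀ m, T m = e m * p := fun m => by simp only [he]; field_simp
  have k1 : (s - 1) * e 1 = s - e 2 / n := by
    simp only [hTe, hxdef] at i1
    field_simp
    refine mul_left_cancel₀ hp.ne' ?_
    linear_combination -i1
  have k2 : (s - 1) * e 2 = 2 * s * e 1 - s - e 3 / n := by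
    simp only [hTe, hxdef] at i2
    field_simp
    refine mul_left_cancel₀ hp.ne' ?_
    linear_combination -i2
  have k3 : (s - 1) * e 3 = 3 * s * e 2 - 3 * s * e 1 + s - e 4 / n := by
    simp only [hTe, hxdef] at i3
    field_simp
    refine mul_left_cancel₀ hp.ne' ?_
    linear_combination -i3
  have hdn : ∀ m, 0 ≤ e m / n := fun m => div_nonneg (hen m) hn0.le
  -- Since all moments are nonnegative, dropping `e (m + 1) / n` closes the hierarchy with bounds
  -- uniform in `n`.
  have b1 : e 1 ≤ s / (s - 1) := by
    rw [le_div_iff₀ hs1]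
    linarith [hdn 2]
  have b2 : e 2 ≤ 2 * s * (s / (s - 1)) / (s - 1) := by
    rw [le_div_iff₀ hs1]
    have := mul_le_mul_of_nonneg_left b1 (show 0 ≤ 2 * s by linarith)
    linarith [hdn 3]
  have b3 : e 3 ≤ (3 * s * (2 * s * (s / (s - 1)) / (s - 1)) + s) / (s - 1) := by
    rw [le_div_iff₀ hs1]
    have := mul_le_mul_of_nonneg_left b2 (show 0 ≤ 3 * s by linarith)
    have h2 := mul_nonneg (show 0 ≤ 3 * s by linarith) (hen 1)
    linarith [hdn 4]
  have key : e 1 - (s / (s - 1) - 1 / n * (s * (s + 1) / (s - 1) ^ 3))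
      = (2 * s / (s - 1) ^ 3 * e 2 + e 3 / (s - 1) ^ 2) / (n : ℝ) ^ 2 := by
    have r1 : e 1 = (s - e 2 / n) / (s - 1) := by rw [← k1]; field_simp
    have r2 : e 2 = (2 * s * e 1 - s - e 3 / n) / (s - 1) := by rw [← k2]; field_simp
    -- The leading term of `e 2`, inserted into `r1`, is the source of the `1 / n` coefficient.
    have r3 : e 2 = s * (s + 1) / (s - 1) ^ 2 - 2 * s * e 2 / (n * (s - 1) ^ 2)
        - e 3 / (n * (s - 1)) := by
      conv_lhs => rw [r2, r1]
      field_simp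
      ring
    conv_lhs => rw [r1, r3]
    field_simp
    ring
  rw [hmean, show T 1 / p = e 1 from rfl, key, abs_of_nonneg]
  · refine div_le_div_of_nonneg_right ?_ (by positivity)
    unfold expansionBound
    gcongr
  · have := hen 2
    have := hen 3
    positivity

/-! ### Expansion of the Berezin kernel and the exact formula. -/

theorem kernel_eq (n : ℕ) (z w : ℂ) :
    kernel n z w = ((n * Real.exp (-(1 / 2) * n * ‖z‖ ^ 2 - (1 / 2) * n * ‖w‖ ^ 2) : ℝ) : ℂ)
      * ∑ j ∈ Finset.range n, ((n : ℂ) * z * conj w) ^ j / (j.factorial : ℂ) := by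
  rw [kernel, ← Finset.sum_mul]
  push_cast
  ring

theorem kernel_self_re (n : ℕ) (z : ℂ) :
    (kernel n z z).re = n * Real.exp (-n * ‖z‖ ^ 2)
      * weightedExpSum n (n * ‖z‖ ^ 2) (fun _ => 1) := by
  have h : kernel n z z = ((n * Real.exp (-n * ‖z‖ ^ 2)
      * weightedExpSum n (n * ‖z‖ ^ 2) (fun _ => 1) : ℝ) : ℂ) := by
    rw [kernel_eq, weightedExpSum, Complex.ofReal_mul (n * Real.exp (-n * ‖z‖ ^ 2))]
    congr 1
    · rw [show -(1 / 2) * (n : ℝ) * ‖z‖ ^ 2 - (1 / 2) * n * ‖z‖ ^ 2 = -n * ‖z‖ ^ 2 by ring]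
    · push_cast
      refine Finset.sum_congr rfl fun j _ => ?_
      rw [mul_assoc, Complex.mul_conj', mul_one]
  rw [h, Complex.ofReal_re]

theorem berezinKernel_eq {n : ℕ} (hn : 1 ≤ n) {z : ℂ} (hz : z ≠ 0) (w : ℂ) :
    (berezinKernel n z w : ℂ) = ∑ j ∈ Finset.range n, ∑ k ∈ Finset.range n,
      (n / weightedExpSum n (n * ‖z‖ ^ 2) (fun _ => 1) : ℂ)
        * ((n * z) ^ j / (j.factorial : ℂ) * ((n * conj z) ^ k / (k.factorial : ℂ)))
        * gaussMonomial n j k w := by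
  have hn0 : (0 : ℝ) < n := by exact_mod_cast hn
  have hz0 : 0 < ‖z‖ := norm_pos_iff.2 hz
  have hp := weightedExpSum_one_pos hn (show 0 < n * ‖z‖ ^ 2 by positivity)
  set p := weightedExpSum n (n * ‖z‖ ^ 2) (fun _ => 1) with hpdef
  set P : ℂ := ∑ j ∈ Finset.range n, ((n : ℂ) * z * conj w) ^ j / (j.factorial : ℂ) with hP
  have h1 : berezinKernel n z w = n / p * (Real.exp (-n * ‖w‖ ^ 2) * ‖P‖ ^ 2) := by
    rw [berezinKernel, kernel_self_re, kernel_eq, norm_mul, Complex.norm_real,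
      Real.norm_of_nonneg (by positivity), mul_pow, mul_pow, ← Real.exp_nat_mul,
      show ((2 : ℕ) : ℝ) * (-(1 / 2) * n * ‖z‖ ^ 2 - (1 / 2) * n * ‖w‖ ^ 2)
        = -n * ‖z‖ ^ 2 + -n * ‖w‖ ^ 2 by push_cast; ring, Real.exp_add, ← hpdef, ← hP]
    have := (Real.exp_pos (-n * ‖z‖ ^ 2)).ne'
    field_simp
  have h2 : ((‖P‖ ^ 2 : ℝ) : ℂ) = ∑ j ∈ Finset.range n, ∑ k ∈ Finset.range n,
      ((n : ℂ) * z * conj w) ^ j / (j.factorial : ℂ)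
        * (((n : ℂ) * conj z * w) ^ k / (k.factorial : ℂ)) := by
    rw [Complex.ofReal_pow, ← Complex.mul_conj', ← Finset.sum_mul_sum, hP]
    congr 1
    simp
  rw [h1, Complex.ofReal_mul, Complex.ofReal_mul, h2, Finset.mul_sum, Finset.mul_sum]
  refine Finset.sum_congr rfl fun j _ => ?_
  rw [Finset.mul_sum, Finset.mul_sum]
  refine Finset.sum_congr rfl fun k _ => ?_
  rw [gaussMonomial]
  push_cast
  ring

theorem berezinKernel_nonneg (n : ℕ) (z w : ℂ) : 0 ≤ berezinKernel n z w := by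
  rw [berezinKernel, kernel_self_re]
  refine div_nonneg (by positivity) (mul_nonneg (by positivity) ?_)
  simpa using weightedExpSum_nonneg (n := n) (x := n * ‖z‖ ^ 2) (by positivity) 0

theorem continuous_berezinKernel (n : ℕ) (z : ℂ) : Continuous (berezinKernel n z) := by
  unfold berezinKernel kernel
  fun_prop

theorem integrable_berezinMeasure_iff (n : ℕ) (z : ℂ) (f : ℂ → ℂ) :
    Integrable f (berezinMeasure n z)
      ↔ Integrable (fun w => (berezinKernel n z w : ℂ) * f w) area := by
  rw [berezinMeasure, integrable_withDensity_iff_integrable_smul'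
    (continuous_berezinKernel n z).measurable.ennreal_ofReal (by simp)]
  simp only [ENNReal.toReal_ofReal (berezinKernel_nonneg _ _ _), Complex.real_smul]

theorem integral_berezinMeasure (n : ℕ) (z : ℂ) (f : ℂ → ℂ) :
    ∫ w, f w ∂(berezinMeasure n z)
      = 1 / (Real.pi : ℂ) * ∫ w, (berezinKernel n z w : ℂ) * f w := by
  rw [berezinMeasure, integral_withDensity_eq_integral_toReal_smul
    (continuous_berezinKernel n z).measurable.ennreal_ofReal (by simp), area,
    integral_smul_measure, ENNReal.toReal_ofReal (by positivity)]
  simp only [ENNReal.toReal_ofReal (berezinKernel_nonneg _ _ _), Complex.real_smul]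
  push_cast
  rfl

theorem integrable_gaussMonomial_mul_cauchyKernel {b : ℝ} (hb : 0 < b) (j k : ℕ) (z : ℂ) :
    Integrable fun w => gaussMonomial b j k w * cauchyKernel z w :=
  integrable_mul_cauchyKernel (continuous_gaussMonomial b j k) (integrable_gaussMonomial hb j k) z

theorem integrable_cauchyKernel_berezinMeasure {n : ℕ} (hn : 1 ≤ n) {z : ℂ} (hz : z ≠ 0) :
    Integrable (cauchyKernel z) (berezinMeasure n z) := by
  have hn0 : (0 : ℝ) < n := by exact_mod_cast hn
  rw [integrable_berezinMeasure_iff, area]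
  refine Integrable.smul_measure ?_ ENNReal.ofReal_ne_top
  simp only [berezinKernel_eq hn hz, Finset.sum_mul]
  refine integrable_finsetSum _ fun j _ => integrable_finsetSum _ fun k _ => ?_
  simp only [mul_assoc]
  simpa only [mul_assoc] using
    ((((integrable_gaussMonomial_mul_cauchyKernel hn0 j k z).const_mul _).const_mul _).const_mul _)

/-- The contribution of the exterior of the disc of radius `|z|` to the Cauchy transform. -/
noncomputable def tailSum (n : ℕ) (z : ℂ) : ℝ :=
  ∑ j ∈ Finset.range n, (n : ℝ) ^ (j + 1) / (Real.pi * j.factorial) * gaussTail n ‖z‖ j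

theorem sum_range_ite_lt {n k : ℕ} (hk : k ≤ n) :
    ∑ j ∈ Finset.range n, (if j < k then (0 : ℝ) else 1) = n - k := by
  obtain ⟨m, rfl⟩ := Nat.exists_eq_add_of_le hk
  rw [Finset.sum_range_add, Finset.sum_eq_zero]
  · simp
  · intro j hj
    rw [if_pos (Finset.mem_range.1 hj)]

theorem integral_cauchyKernel_berezinMeasure {n : ℕ} (hn : 1 ≤ n) {z : ℂ} (hz : z ≠ 0) :
    ∫ w, cauchyKernel z w ∂(berezinMeasure n z)
      = 1 / z * ((truncatedMean n (‖z‖ ^ 2) - tailSum n z : ℝ) : ℂ) := by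
  have hn0 : (0 : ℝ) < n := by exact_mod_cast hn
  have hz0 : 0 < ‖z‖ := norm_pos_iff.2 hz
  have hp := weightedExpSum_one_pos hn (show 0 < n * ‖z‖ ^ 2 by positivity)
  have hterm : ∀ j k : ℕ, Integrable fun w =>
      (n / weightedExpSum n (n * ‖z‖ ^ 2) (fun _ => 1) : ℂ)
        * ((n * z) ^ j / (j.factorial : ℂ) * ((n * conj z) ^ k / (k.factorial : ℂ)))
        * (gaussMonomial n j k w * cauchyKernel z w) := fun j k =>
    (integrable_gaussMonomial_mul_cauchyKernel hn0 j k z).const_mul _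
  rw [integral_berezinMeasure]
  simp only [berezinKernel_eq hn hz, Finset.sum_mul]
  simp only [mul_assoc (_ * _) (gaussMonomial _ _ _ _) _]
  rw [integral_finsetSum _ fun j _ => integrable_finsetSum _ fun k _ => hterm j k]
  simp only [integral_finsetSum _ fun k _ => hterm _ k, integral_const_mul,
    integral_gaussMonomial_mul_cauchyKernel hn0 hz]
  set p := weightedExpSum n (n * ‖z‖ ^ 2) (fun _ => 1) with hpdef
  -- For fixed `k`, the indices `k ≤ j < n` number `n - k`; hence the mean. The tail term is
  -- independent of `k`, so its weights sum to 1.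
  have hmain : truncatedMean n (‖z‖ ^ 2) - tailSum n z
      = ∑ j ∈ Finset.range n, ∑ k ∈ Finset.range n,
        (n * ‖z‖ ^ 2) ^ k / k.factorial / p * ((if j < k then (0 : ℝ) else 1)
          - (n : ℝ) ^ (j + 1) / (Real.pi * j.factorial) * gaussTail n ‖z‖ j) := by
    have hp1 : (∑ k ∈ Finset.range n, ((n : ℝ) * ‖z‖ ^ 2) ^ k / k.factorial) = p := by
      simp [hpdef, weightedExpSum]
    have hk : ∀ k ∈ Finset.range n, (∑ j ∈ Finset.range n,
        (n * ‖z‖ ^ 2) ^ k / k.factorial / p * ((if j < k then (0 : ℝ) else 1)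
          - (n : ℝ) ^ (j + 1) / (Real.pi * j.factorial) * gaussTail n ‖z‖ j))
        = (n * ‖z‖ ^ 2) ^ k / k.factorial * (n - k) / p
          - (n * ‖z‖ ^ 2) ^ k / k.factorial * (tailSum n z / p) := by
      intro k hk
      rw [← Finset.mul_sum, Finset.sum_sub_distrib, sum_range_ite_lt (Finset.mem_range.1 hk).le,
        tailSum]
      ring
    rw [Finset.sum_comm, Finset.sum_congr rfl hk, Finset.sum_sub_distrib, ← Finset.sum_div,
      ← Finset.sum_mul, hp1, mul_div_cancel₀ _ hp.ne']
    rfl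
  rw [hmain]
  push_cast
  rw [Finset.mul_sum, Finset.mul_sum]
  refine Finset.sum_congr rfl fun j _ => ?_
  rw [Finset.mul_sum, Finset.mul_sum]
  refine Finset.sum_congr rfl fun k _ => ?_
  have hpi : (Real.pi : ℂ) ≠ 0 := by exact_mod_cast Real.pi_ne_zero
  have hpc : (p : ℂ) ≠ 0 := by exact_mod_cast hp.ne'
  have hnc : (n : ℂ) ≠ 0 := by exact_mod_cast hn0.ne'
  have hj : (j.factorial : ℂ) ≠ 0 := by exact_mod_cast j.factorial_ne_zero
  have hk : (k.factorial : ℂ) ≠ 0 := by exact_mod_cast k.factorial_ne_zero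
  have hs : (‖z‖ : ℂ) ^ 2 = z * conj z := (Complex.mul_conj' z).symm
  rw [hs]
  simp only [mul_pow, pow_succ]
  field_simp

/-! ### Exponential smallness of the tail, and the conclusion. -/

theorem tailSum_nonneg (n : ℕ) (z : ℂ) : 0 ≤ tailSum n z :=
  Finset.sum_nonneg fun j _ => mul_nonneg (by positivity) (gaussTail_nonneg _ _ _)

theorem tailSum_le {n : ℕ} (hn : 1 ≤ n) {z : ℂ} (hz : 1 < ‖z‖) :
    tailSum n z ≤ n * (‖z‖ ^ 2 * Real.exp (-(‖z‖ ^ 2 - 1))) ^ n := by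
  have hn0 : (0 : ℝ) < n := by exact_mod_cast hn
  have hz0 : 0 < ‖z‖ := by linarith
  have hs : 1 ≤ ‖z‖ ^ 2 := one_le_pow₀ hz.le
  have h : ∀ j ∈ Finset.range n,
      (n : ℝ) ^ (j + 1) / (Real.pi * j.factorial) * gaussTail n ‖z‖ j
        ≤ (‖z‖ ^ 2 * Real.exp (-(‖z‖ ^ 2 - 1))) ^ n := by
    intro j hj
    calc (n : ℝ) ^ (j + 1) / (Real.pi * j.factorial) * gaussTail n ‖z‖ j
        ≤ (n : ℝ) ^ (j + 1) / (Real.pi * j.factorial) * (Real.exp (-n * (‖z‖ ^ 2 - 1))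
          * (Real.pi * j.factorial / (n / ‖z‖ ^ 2) ^ (j + 1))) := by
          gcongr
          exact gaussTail_le hn0 hz j
      _ = (‖z‖ ^ 2) ^ (j + 1) * Real.exp (-n * (‖z‖ ^ 2 - 1)) := by
          have : (j.factorial : ℝ) ≠ 0 := by exact_mod_cast j.factorial_ne_zero
          rw [div_pow]
          field_simp
      _ ≤ (‖z‖ ^ 2) ^ n * Real.exp (-n * (‖z‖ ^ 2 - 1)) := by
          gcongr
          exact Finset.mem_range.1 hj
      _ = (‖z‖ ^ 2 * Real.exp (-(‖z‖ ^ 2 - 1))) ^ n := by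
          rw [mul_pow, ← Real.exp_nat_mul]
          ring_nf
  refine (Finset.sum_le_sum h).trans ?_
  simp

theorem tailSum_isBigO {z : ℂ} (hz : 1 < ‖z‖) :
    (fun n : ℕ => tailSum n z) =O[atTop] (fun n : ℕ => 1 / (n : ℝ) ^ 2) := by
  set q := ‖z‖ ^ 2 * Real.exp (-(‖z‖ ^ 2 - 1)) with hq
  have hs : 1 < ‖z‖ ^ 2 := one_lt_pow₀ hz two_ne_zero
  have hq0 : 0 ≤ q := by positivity
  have hq1 : q < 1 := by
    rw [hq, Real.exp_neg, ← div_eq_mul_inv, div_lt_one (Real.exp_pos _)]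
    have := Real.add_one_lt_exp (x := ‖z‖ ^ 2 - 1) (by linarith)
    linarith
  -- The power 3 combines the factor `n` in `tailSum_le` with the target rate `1 / n²`.
  have hlim := tendsto_pow_const_mul_const_pow_of_abs_lt_one 3 (r := q)
    (by rwa [abs_of_nonneg hq0])
  refine IsBigO.of_bound 1 ?_
  filter_upwards [hlim.eventually_lt_const one_pos, eventually_ge_atTop 1] with n h1 hn
  have hn0 : (0 : ℝ) < n := by exact_mod_cast hn
  rw [Real.norm_of_nonneg (tailSum_nonneg n z), Real.norm_of_nonneg (by positivity), one_mul,
    le_div_iff₀ (by positivity)]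
  have := tailSum_le hn hz
  calc tailSum n z * (n : ℝ) ^ 2 ≤ n * q ^ n * (n : ℝ) ^ 2 := by gcongr
    _ = (n : ℝ) ^ 3 * q ^ n := by ring
    _ ≤ 1 := h1.le

theorem truncatedMean_isBigO {s : ℝ} (hs : 1 < s) :
    (fun n : ℕ => truncatedMean n s - (s / (s - 1) - 1 / n * (s * (s + 1) / (s - 1) ^ 3)))
      =O[atTop] (fun n : ℕ => 1 / (n : ℝ) ^ 2) := by
  refine IsBigO.of_bound (expansionBound s) ?_
  filter_upwards [eventually_ge_atTop 1] with n hn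
  rw [Real.norm_eq_abs, Real.norm_of_nonneg (by positivity), mul_one_div]
  exact abs_truncatedMean_sub_le hn hs

end Ginibre

theorem theorem6p4 (z : ℂ) (hz : 1 < ‖z‖) :
    (∀ n : ℕ, 1 ≤ n →
      Integrable (Ginibre.cauchyKernel z) (Ginibre.berezinMeasure n z)) ∧
    (fun n : ℕ =>
        (∫ w, Ginibre.cauchyKernel z w ∂(Ginibre.berezinMeasure n z))
          - (conj z / ((‖z‖ : ℂ) ^ 2 - 1)
              - (1 / (n : ℂ)) *
                (conj z * ((‖z‖ : ℂ) ^ 2 + 1) / ((‖z‖ : ℂ) ^ 2 - 1) ^ 3)))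
      =O[atTop] (fun n : ℕ => 1 / (n : ℝ) ^ 2) := by
  have hz0 : z ≠ 0 := norm_pos_iff.1 (by linarith)
  refine ⟨fun n hn => Ginibre.integrable_cauchyKernel_berezinMeasure hn hz0, ?_⟩
  have hs : 1 < ‖z‖ ^ 2 := one_lt_pow₀ hz two_ne_zero
  have h := (Ginibre.truncatedMean_isBigO hs).sub (Ginibre.tailSum_isBigO hz)
  have h' := (isBigO_norm_left.1 ((isBigO_norm_left.2 h).congr_left
    fun n => (Complex.norm_real _).symm)).const_mul_left (1 / z)
  refine h'.congr' ?_ EventuallyEq.rfl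
  filter_upwards [eventually_ge_atTop 1] with n hn
  rw [Ginibre.integral_cauchyKernel_berezinMeasure hn hz0]
  have hs' : (‖z‖ : ℂ) ^ 2 - 1 ≠ 0 := by
    have : ‖z‖ ^ 2 - 1 ≠ 0 := by linarith
    exact_mod_cast this
  -- This turns the prefactor `1 / z` times the numerator `s` into `conj z`.
  have hzz : conj z = (‖z‖ : ℂ) ^ 2 / z := by
    rw [← Complex.mul_conj']
    field_simp
  rw [hzz]
  push_cast
  ring
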